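/- Let $D$ be a strong digraph (loops allowed, no multiple arcs) with a finite or countably infinite vertex set $V$ and at least one arc; strong means that for any two distinct vertices $v,w$ there is a directed path from $v$ to $w$. For a non-negative real matrix $M$ indexed by $V\times V$, let $\lambda_n(M)$ be the supremum of the spectral radii of its principal submatrices of order $n$, and let $\lambda(M)$ be the supremum of the spectral radii of all its finite principal submatrices. The digraph of $M$ has the arc $(v,w)$ if and only if $M(v,w)\neq 0$. Let $\mathcal T(D)$ be the set of all transient matrices with digraph $D$, that is, of all non-negative $M$ with digraph $D$ such that $\lambda(M)<\infty$ and the series $\sum_{p=0}^{\infty}M^{p}\lambda(M)^{-p}$ converges entrywise. Then exactly one of the following two alternatives holds. 1. For every function $g$ on the positive integers with positive real values there is $M\in\mathcal T(D)$ such that $\lambda(M)-\lambda_n(M)<g(n)$ for all $n\ge 1$. 2. For every $M\in\mathcal T(D)$ there is a constant $c_M>0$, not depending on $n$, such that $n\bigl(\lambda(M)-\lambda_n(M)\bigr)>c_M$ for all $n\ge 1$. Alternative 2 holds if and only if $D$ has a finite cycle transversal, that is, a finite set of vertices whose removal, together with all incident arcs, leaves a digraph without directed cycles (loops count as directed cycles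 of length one). (If $\mathcal T(D)=\emptyset$, then alternative 2 holds vacuously. For finite $V$ the set $\mathcal T(D)$ is always empty, so the value of $\lambda_n(M)$ for $n>|V|$, where the supremum is over the empty set, plays no role.) -/

import Mathlib

open scoped ENNReal NNReal

namespace Digraph

/-- A digraph (loops allowed, no multiple arcs) is strong if there is a directed walk from each
vertex to each other one. -/
def IsStrong {V : Type*} (D : Digraph V) : Prop :=
  ∀ v w : V, v ≠ w → Relation.TransGen D.Adj v w

/-- A directed cycle: a nonempty cyclic sequence of distinct vertices in which every vertex is
joined by an arc to the next one. A loop is a directed cycle of length one. -/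
def IsDirectedCycle {V : Type*} (D : Digraph V) (c : Cycle V) : Prop :=
  c ≠ Cycle.nil ∧ c.Nodup ∧ c.Chain D.Adj

/-- The subdigraph obtained by removing the vertices of `T` and all arcs incident to them. -/
def deleteVertices {V : Type*} (D : Digraph V) (T : Set V) : Digraph {v : V // v ∉ T} where
  Adj v w := D.Adj v.1 w.1

/-- The set `T` of vertices is a cycle transversal: its removal leaves no directed cycle. -/
def IsCycleTransversal {V : Type*} (D : Digraph V) (T : Set V) : Prop :=
  ∀ c : Cycle {v : V // v ∉ T}, ¬ (D.deleteVertices T).IsDirectedCycle c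

end Digraph

namespace NonnegMatrix

/-- The digraph of a non-negative matrix: `(v, w)` is an arc iff the `(v, w)` entry is non-zero. -/
def digraph {V : Type*} (M : Matrix V V ℝ≥0) : Digraph V where
  Adj v w := M v w ≠ 0

/-- The principal submatrix with finite index set `F`, as a complex matrix. -/
def principal {V : Type*} (M : Matrix V V ℝ≥0) (F : Finset V) : Matrix F F ℂ :=
  fun v w => ((M v.1 w.1 : ℝ) : ℂ)

open Classical in
/-- The spectral radius (Perron root) of the principal submatrix with finite index set `F`: the
largest modulus of its complex eigenvalues. -/
noncomputable def perronRoot {V : Type*} (M : Matrix V V ℝ≥0) (F : Finset V) : ℝ≥0∞ :=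
  spectralRadius ℂ (principal M F)

/-- `λ_n(M)`: the supremum of the spectral radii of the principal submatrices of order `n`. -/
noncomputable def lambdaN {V : Type*} (M : Matrix V V ℝ≥0) (n : ℕ) : ℝ≥0∞ :=
  ⨆ (F : Finset V) (_ : F.card = n), perronRoot M F

/-- `λ(M)`: the intrinsic spectral radius, the supremum of the spectral radii of all finite
principal submatrices. -/
noncomputable def lambda {V : Type*} (M : Matrix V V ℝ≥0) : ℝ≥0∞ :=
  ⨆ F : Finset V, perronRoot M F

open Classical in
/-- The `(v, w)` entry of the power `M ^ p` of a possibly infinite non-negative matrix (the value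
`∞` is allowed). -/
noncomputable def powEntry {V : Type*} (M : Matrix V V ℝ≥0) : ℕ → V → V → ℝ≥0∞
  | 0, v, w => if v = w then 1 else 0
  | p + 1, v, w => ∑' u : V, powEntry M p v u * (M u w : ℝ≥0∞)

/-- `M` is transient: `λ(M)` is finite and the series of the `M ^ p * z ^ (-p)`, `p ≥ 0`,
converges entrywise at `z = λ(M)`. -/
def IsTransient {V : Type*} (M : Matrix V V ℝ≥0) : Prop :=
  lambda M ≠ ∞ ∧ ∀ v w : V, ∑' p : ℕ, powEntry M p v w / lambda M ^ p ≠ ∞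

/-- The class `T(D)` of all transient matrices whose digraph is `D`. -/
def transientClass {V : Type*} (D : Digraph V) : Set (Matrix V V ℝ≥0) :=
  {M | digraph M = D ∧ IsTransient M}

/-- The difference `λ(M) - λ_n(M)` as a real number (used only for `λ(M) < ∞`). -/
noncomputable def gap {V : Type*} (M : Matrix V V ℝ≥0) (n : ℕ) : ℝ :=
  (lambda M).toReal - (lambdaN M n).toReal

/-- Arbitrarily fast finite approximation on `T(D)`. -/
def FastApproximation {V : Type*} (D : Digraph V) : Prop :=
  ∀ g : ℕ → ℝ, (∀ n, 1 ≤ n → 0 < g n) →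
    ∃ M ∈ transientClass D, ∀ n, 1 ≤ n → gap M n < g n

/-- On all of `T(D)`, the quantity `n (λ(M) - λ_n(M))` is bounded away from zero. -/
def SlowApproximation {V : Type*} (D : Digraph V) : Prop :=
  ∀ M ∈ transientClass D, ∃ c : ℝ, 0 < c ∧ ∀ n : ℕ, 1 ≤ n → c < n * gap M n

end NonnegMatrix

/-! ### Closed walks and directed cycles -/

namespace Digraph

/-! Write L for λ(M). If T is a finite transversal and M is transient, the sum over t in T of the
Green functions G(·, t) at L is a positive vector u with Mu ≤ Lu everywhere and Mu ≤ rLu on T for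
some r < 1 (`IsTransient.exists_superharmonic`). In a principal submatrix of order n every closed
walk meets T, so the deficit on T can be spread over all rows: multiplying u by powers of s =
r^(1/(n+1)) that increase along arcs outside T gives λ_n ≤ sL (`perronRoot_le_of_superharmonic`).
Bernoulli's inequality makes 1 - s at least (1 - r)/(n + 1).

If no finite transversal exists, there are infinitely many disjoint cycles C_k. Weights L - d_k
along C_k, and tiny weights on all other arcs, keep every row sum strictly below L, which forces
transience once λ = L. The cycles give λ_n ≥ L - d_k as soon as n is at least the total size of C_0,
..., C_k, and d_k may decrease as fast as desired. -/

theorem exists_isDirectedCycle_of_transGen {W : Type*} (D : Digraph W) {v : W}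
    (h : Relation.TransGen D.Adj v v) : ∃ c : Cycle W, D.IsDirectedCycle c := by
  -- A closed walk that repeats x is rotated to start at x and cut at the next occurrence of x,
  -- which leaves a shorter closed walk.
  have key : ∀ n : ℕ, ∀ l : List W, l.length = n → l ≠ [] → Cycle.Chain D.Adj (l : Cycle W) →
      ∃ c : Cycle W, D.IsDirectedCycle c := by
    intro n
    induction n using Nat.strong_induction_on with
    | _ n ih =>
      intro l hl hne hc
      by_cases hnd : l.Nodup
      · exact ⟨l, by simpa using hne, by simpa using hnd, hc⟩
      · obtain ⟨x, hx⟩ : ∃ x, List.Duplicate x l := by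
          by_contra hcon
          exact hnd ((List.nodup_iff_forall_not_duplicate).2 (fun x hx => hcon ⟨x, hx⟩))
        obtain ⟨l₀, l', rfl⟩ := List.append_of_mem hx.mem
        have hrot : ((l₀ ++ x :: l' : List W) : Cycle W) = ((x :: (l' ++ l₀) : List W) : Cycle W) := by
          rw [Cycle.coe_eq_coe]
          simpa using (List.isRotated_append (l := l₀) (l' := x :: l'))
        have hxm : x ∈ l' ++ l₀ := by
          have h1 : List.Duplicate x (x :: (l' ++ l₀)) := by
            classical
            rw [List.duplicate_iff_two_le_count] at hx ⊢
            simp only [List.count_append, List.count_cons] at hx ⊢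
            omega
          simpa using h1
        obtain ⟨l₁, l₂, h12⟩ := List.append_of_mem hxm
        rw [hrot, h12, Cycle.chain_coe_cons] at hc
        have hc' : Cycle.Chain D.Adj ((x :: l₁ : List W) : Cycle W) := by
          rw [Cycle.chain_coe_cons]
          exact List.IsChain.prefix hc (by simp)
        refine ih (x :: l₁).length ?_ _ rfl (by simp) hc'
        have := congrArg List.length h12
        simp only [List.length_append, List.length_cons] at this hl ⊢
        omega
  obtain ⟨w, hvw, hwv⟩ := Relation.TransGen.head'_iff.1 h
  obtain ⟨l, hl, hlast⟩ := List.exists_isChain_cons_of_relationReflTransGen hwv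
  have hne : v ∈ w :: l := hlast ▸ List.getLast_mem _
  have hdl := List.dropLast_append_getLast (l := w :: l) (by simp)
  rw [hlast] at hdl
  refine key _ (v :: (w :: l).dropLast) rfl (by simp) ?_
  rw [Cycle.chain_coe_cons, hdl]
  exact List.isChain_cons_cons.2 ⟨hvw, hl⟩

/-- All that `le_perronRoot` needs from a cycle is a finite set in which every vertex has a
successor. -/
theorem IsDirectedCycle.exists_finset {W : Type*} {D : Digraph W} {c : Cycle W}
    (h : D.IsDirectedCycle c) :
    ∃ C : Finset W, C.Nonempty ∧ ∀ v ∈ C, ∃ w ∈ C, D.Adj v w := by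
  classical
  obtain ⟨hne, hnd, hch⟩ := h
  induction c using Quotient.inductionOn' with
  | h l =>
    change ((l : Cycle W)) ≠ Cycle.nil at hne
    change Cycle.Chain D.Adj (l : Cycle W) at hch
    cases l with
    | nil => simp at hne
    | cons a l =>
      refine ⟨(a :: l).toFinset, ⟨a, by simp⟩, fun v hv => ?_⟩
      rw [Cycle.chain_coe_cons] at hch
      rw [List.mem_toFinset] at hv
      obtain ⟨l₁, l₂, h12⟩ := List.append_of_mem hv
      have h3 : a :: (l ++ [a]) = l₁ ++ v :: (l₂ ++ [a]) := by
        rw [← List.cons_append, h12]; simp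
      rw [h3] at hch
      have h4 := hch.right_of_append
      cases l₂ with
      | nil =>
        exact ⟨a, by simp, by simpa using h4⟩
      | cons b l₂ =>
        refine ⟨b, ?_, ?_⟩
        · rw [List.mem_toFinset, h12]; simp
        · simp only [List.cons_append, List.isChain_cons_cons] at h4
          exact h4.1

end Digraph

namespace NonnegMatrix

variable {V : Type*}

/-! ### Bounds for the Perron root -/

/-- Collatz–Wielandt bound: for an eigenvector y, compare both sides of the eigenvalue equation at
an index that maximizes |y_i| / x_i. -/
theorem perronRoot_le {M : Matrix V V ℝ≥0} {F : Finset V} {x : V → ℝ≥0} {s : ℝ≥0}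
    (hx : ∀ v ∈ F, 0 < x v) (h : ∀ v ∈ F, ∑ w ∈ F, M v w * x w ≤ s * x v) :
    perronRoot M F ≤ s := by
  classical
  unfold perronRoot spectralRadius
  refine iSup₂_le fun μ hμ => ?_
  rw [← Matrix.spectrum_toLin', ← Module.End.hasEigenvalue_iff_mem_spectrum] at hμ
  obtain ⟨y, hy⟩ := hμ.exists_hasEigenvector
  have hyne := hy.2
  have hye := hy.apply_eq_smul
  obtain ⟨i₀, hi₀⟩ := Function.ne_iff.1 hyne
  obtain ⟨i, -, hi⟩ := Finset.exists_max_image (Finset.univ : Finset F)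
    (fun j => ‖y j‖₊ / x j) ⟨i₀, Finset.mem_univ _⟩
  set m := ‖y i‖₊ / x i with hm
  have hmpos : 0 < m := lt_of_lt_of_le
    (div_pos (by simpa using hi₀) (hx _ i₀.2)) (hi i₀ (Finset.mem_univ _))
  have hle : ∀ j : F, ‖y j‖₊ ≤ m * x j := fun j =>
    (div_le_iff₀ (hx _ j.2)).1 (hi j (Finset.mem_univ _))
  have hyi : ‖y i‖₊ = m * x i := by rw [hm, div_mul_cancel₀ _ (hx _ i.2).ne']
  have h1 : ‖μ‖₊ * ‖y i‖₊ ≤ s * (m * x i) := by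
    have h2 := congrFun hye i
    rw [Matrix.toLin'_apply, Pi.smul_apply, smul_eq_mul] at h2
    rw [← nnnorm_mul, ← h2]
    calc ‖(principal M F).mulVec y i‖₊ ≤ ∑ j : F, ‖principal M F i j * y j‖₊ := by
          simpa [Matrix.mulVec, dotProduct] using
            nnnorm_sum_le (Finset.univ : Finset F) (fun j => principal M F i j * y j)
      _ = ∑ j : F, M i j * ‖y j‖₊ := by
          refine Finset.sum_congr rfl fun j _ => ?_
          rw [nnnorm_mul]; congr 1
          ext; simp [principal]
      _ ≤ ∑ j : F, M i j * (m * x j) := by gcongr with j; exact hle j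
      _ = m * ∑ j : F, M i j * x j := by
          rw [Finset.mul_sum]; refine Finset.sum_congr rfl fun j _ => by ring
      _ = m * ∑ j ∈ F, M i j * x j := by
          rw [Finset.sum_coe_sort F (fun j => M i j * x j)]
      _ ≤ m * (s * x i) := by gcongr; exact h i i.2
      _ = s * (m * x i) := by ring
  rw [hyi] at h1
  exact_mod_cast le_of_mul_le_mul_right h1 (mul_pos hmpos (hx _ i.2))

/-- Following successors inside C, the p-th power has row sums at least s ^ p on C; Gelfand's
formula in the maximal row sum norm finishes. -/
theorem le_perronRoot {M : Matrix V V ℝ≥0} {C F : Finset V} {s : ℝ≥0} (hCF : C ⊆ F)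
    (hC : C.Nonempty) (h : ∀ v ∈ C, ∃ w ∈ C, s ≤ M v w) : s ≤ perronRoot M F := by
  classical
  let P : Matrix F F ℝ≥0 := fun v w => M v w
  have hpow : ∀ p : ℕ, ∀ v : F, v.1 ∈ C →
      s ^ p ≤ ∑ w : F, (P ^ p) v w * (if w.1 ∈ C then 1 else 0) := by
    intro p
    induction p with
    | zero =>
      intro v hv
      rw [Finset.sum_eq_single v (fun w _ hw => by simp [hw.symm]) (by simp)]
      simp [hv]
    | succ p ih =>
      intro v hv
      obtain ⟨w, hw, hs⟩ := h v hv
      have := ih ⟨w, hCF hw⟩ hw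
      calc s ^ (p + 1) = s * s ^ p := pow_succ' _ _
        _ ≤ P v ⟨w, hCF hw⟩ *
            ∑ u : F, (P ^ p) ⟨w, hCF hw⟩ u * (if u.1 ∈ C then 1 else 0) := mul_le_mul' hs this
        _ ≤ ∑ z : F, P v z * ∑ u : F, (P ^ p) z u * (if u.1 ∈ C then 1 else 0) :=
            Finset.single_le_sum
              (f := fun z => P v z * ∑ u : F, (P ^ p) z u * (if u.1 ∈ C then 1 else 0))
              (fun _ _ => zero_le) (Finset.mem_univ _)
        _ = ∑ u : F, (P ^ (p + 1)) v u * (if u.1 ∈ C then 1 else 0) := by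
            simp_rw [pow_succ', Matrix.mul_apply, Finset.mul_sum, Finset.sum_mul]
            rw [Finset.sum_comm]
            simp_rw [mul_assoc]
  have hmap : ∀ p : ℕ, ∀ v w : F, ((principal M F) ^ p) v w = (((P ^ p) v w : ℝ≥0) : ℂ) := by
    intro p
    induction p with
    | zero => intro v w; by_cases h : v = w <;> simp [h]
    | succ p ih =>
      intro v w
      simp only [pow_succ, Matrix.mul_apply, ih]
      push_cast
      rfl
  let _ : NormedRing (Matrix F F ℂ) := Matrix.linftyOpNormedRing
  let _ : NormedAlgebra ℂ (Matrix F F ℂ) := Matrix.linftyOpNormedAlgebra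
  have _ : CompleteSpace (Matrix F F ℂ) := FiniteDimensional.complete ℂ _
  obtain ⟨v, hv⟩ := hC
  have hnorm : ∀ p : ℕ, s ^ p ≤ ‖(principal M F) ^ p‖₊ := by
    intro p
    rw [Matrix.linfty_opNNNorm_def]
    refine le_trans (hpow p ⟨v, hCF hv⟩ hv) (le_trans ?_ (Finset.le_sup
      (f := fun i : F => ∑ j, ‖((principal M F) ^ p) i j‖₊) (Finset.mem_univ ⟨v, hCF hv⟩)))
    refine Finset.sum_le_sum fun w _ => ?_
    rw [hmap]
    split_ifs <;> simp
  have hlim := spectrum.pow_nnnorm_pow_one_div_tendsto_nhds_spectralRadius (principal M F)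
  have : (s : ℝ≥0∞) ≤ spectralRadius ℂ (principal M F) := by
    refine ge_of_tendsto hlim ?_
    filter_upwards [Filter.eventually_gt_atTop 0] with p hp
    have h1 : ((s : ℝ≥0∞) ^ p) ≤ (‖(principal M F) ^ p‖₊ : ℝ≥0∞) := by exact_mod_cast hnorm p
    calc (s : ℝ≥0∞) = ((s : ℝ≥0∞) ^ p) ^ (1 / p : ℝ) := by
          rw [← ENNReal.rpow_natCast, ← ENNReal.rpow_mul, mul_one_div_cancel (by positivity),
            ENNReal.rpow_one]
      _ ≤ _ := ENNReal.rpow_le_rpow h1 (by positivity)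
  unfold perronRoot
  convert this

/-! ### Matrix powers and transience -/

theorem powEntry_succ' (M : Matrix V V ℝ≥0) (p : ℕ) (v w : V) :
    powEntry M (p + 1) v w = ∑' u : V, (M v u : ℝ≥0∞) * powEntry M p u w := by
  induction p generalizing w with
  | zero =>
    simp only [powEntry]
    rw [tsum_eq_single v (by intro u hu; simp [hu.symm]),
      tsum_eq_single w (by intro u hu; simp [hu])]
    simp
  | succ p ih =>
    rw [powEntry]
    simp_rw [ih, ← ENNReal.tsum_mul_right]
    rw [ENNReal.tsum_comm]
    refine tsum_congr fun u => ?_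
    rw [powEntry, ← ENNReal.tsum_mul_left]
    exact tsum_congr fun z => mul_assoc _ _ _

theorem powEntry_succ_ne_zero {M : Matrix V V ℝ≥0} {p : ℕ} {v u w : V}
    (h : powEntry M p v u ≠ 0) (hM : M u w ≠ 0) : powEntry M (p + 1) v w ≠ 0 := by
  rw [powEntry, Ne, ENNReal.tsum_eq_zero]
  intro h0
  have := h0 u
  simp [h, hM] at this

theorem exists_powEntry_ne_zero {M : Matrix V V ℝ≥0} {v w : V}
    (h : Relation.ReflTransGen (digraph M).Adj v w) : ∃ p, powEntry M p v w ≠ 0 := by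
  induction h with
  | refl => exact ⟨0, by simp [powEntry]⟩
  | tail _ hM ih =>
    obtain ⟨p, hp⟩ := ih
    exact ⟨p + 1, powEntry_succ_ne_zero hp hM⟩

theorem IsTransient.lambda_ne_zero {M : Matrix V V ℝ≥0} (hM : IsTransient M) {v w : V}
    (h : M v w ≠ 0) : lambda M ≠ 0 := by
  intro h0
  refine hM.2 v w (top_unique ?_)
  refine le_trans ?_ (ENNReal.le_tsum 1)
  have : powEntry M 1 v w ≠ 0 :=
    powEntry_succ_ne_zero (p := 0) (u := v) (by simp [powEntry]) h
  simp [h0, ENNReal.div_zero this]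

theorem lambdaN_le_lambda (M : Matrix V V ℝ≥0) (n : ℕ) : lambdaN M n ≤ lambda M :=
  iSup_le fun F => iSup_le fun _ => le_iSup (perronRoot M) F

theorem lambda_le_of_rowSum_le {M : Matrix V V ℝ≥0} {L : ℝ≥0}
    (h : ∀ v, ∑' w, (M v w : ℝ≥0∞) ≤ L) : lambda M ≤ L := by
  refine iSup_le fun F => perronRoot_le (x := fun _ => 1) (fun _ _ => one_pos) fun v _ => ?_
  have h1 := (ENNReal.sum_le_tsum F).trans (h v)
  simp only [mul_one]
  exact_mod_cast h1

/-- M / L is a killed random walk: each visit to w loses mass at least δ w / L, and the initial mass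
is 1, so the expected number of visits is at most L / δ w. -/
theorem isTransient_of_rowSum_lt {M : Matrix V V ℝ≥0} {L : ℝ≥0} (hL : L ≠ 0)
    {δ : V → ℝ≥0} (hδ : ∀ v, δ v ≠ 0) (h : ∀ v, ∑' w, (M v w : ℝ≥0∞) + δ v ≤ L)
    (hM : lambda M = L) : IsTransient M := by
  refine ⟨by simp [hM], fun v w => ?_⟩
  have hL' : (L : ℝ≥0∞) ≠ 0 := by exact_mod_cast hL
  have hδw : (δ w : ℝ≥0∞) ≠ 0 := by exact_mod_cast hδ w
  set a : ℕ → ℝ≥0∞ := fun p => (∑' u, powEntry M p v u) / (L : ℝ≥0∞) ^ p with ha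
  set b : ℕ → ℝ≥0∞ := fun p => powEntry M p v w / (L : ℝ≥0∞) ^ p with hb
  have hstep : ∀ p, a (p + 1) + b p * (δ w / L) ≤ a p := by
    intro p
    have h1 : ∑' u, powEntry M (p + 1) v u + powEntry M p v w * δ w ≤
        (∑' u, powEntry M p v u) * L := by
      calc ∑' u, powEntry M (p + 1) v u + powEntry M p v w * δ w
          ≤ ∑' u, powEntry M (p + 1) v u + ∑' u, powEntry M p v u * δ u := by
            gcongr; exact ENNReal.le_tsum (f := fun u => powEntry M p v u * δ u) w
        _ = ∑' u, powEntry M p v u * (∑' z, (M u z : ℝ≥0∞) + δ u) := by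
            simp_rw [powEntry]
            rw [ENNReal.tsum_comm, ← ENNReal.tsum_add]
            simp_rw [mul_add, ENNReal.tsum_mul_left]
        _ ≤ ∑' u, powEntry M p v u * L := by gcongr with u; exact h u
        _ = _ := ENNReal.tsum_mul_right
    have h2 : a p = (∑' u, powEntry M p v u) * L / (L : ℝ≥0∞) ^ (p + 1) := by
      rw [ha, pow_succ, ENNReal.mul_div_mul_right _ _ hL' ENNReal.coe_ne_top]
    have h3 : b p * (δ w / L) = powEntry M p v w * δ w / (L : ℝ≥0∞) ^ (p + 1) := by
      simp only [hb, div_eq_mul_inv, pow_succ]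
      rw [ENNReal.mul_inv (by simp) (by simp)]
      ring
    rw [h2, h3, ← ENNReal.add_div]
    gcongr
  have hsum : ∀ P, a P + (∑ p ∈ Finset.range P, b p) * (δ w / L) ≤ 1 := by
    intro P
    induction P with
    | zero =>
      have : ∑' u, powEntry M 0 v u = 1 := by
        rw [tsum_eq_single v (by intro u hu; simp [powEntry, hu.symm])]
        simp [powEntry]
      simp [ha, this]
    | succ P ih =>
      refine le_trans ?_ ih
      rw [Finset.sum_range_succ, add_mul, add_comm (_ * _), ← add_assoc]
      gcongr
      exact hstep P
  have hfin : (∑' p, b p) * (δ w / L) ≤ 1 := by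
    rw [← ENNReal.tsum_mul_right]
    refine ENNReal.tsum_le_of_sum_range_le fun P => ?_
    rw [← Finset.sum_mul]
    exact le_trans le_add_self (hsum P)
  rw [hM]
  intro htop
  rw [htop, ENNReal.top_mul (by simp [hδw])] at hfin
  simp at hfin

/-! ### Slow approximation from a finite transversal -/

theorem tsum_powEntry_div_eq (M : Matrix V V ℝ≥0) (L : ℝ≥0∞) (v t : V) :
    ∑' p, powEntry M p v t / L ^ p =
      powEntry M 0 v t + (∑' w, (M v w : ℝ≥0∞) * ∑' p, powEntry M p w t / L ^ p) / L := by
  have h1 : ∑' p, powEntry M p v t / L ^ p =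
      powEntry M 0 v t / L ^ 0 + ∑' p, powEntry M (p + 1) v t / L ^ (p + 1) :=
    tsum_eq_zero_add' ENNReal.summable
  have h2 : ∀ p, powEntry M (p + 1) v t / L ^ (p + 1) =
      ∑' w, (M v w : ℝ≥0∞) * (powEntry M p w t / L ^ p) / L := by
    intro p
    rw [powEntry_succ']
    simp only [div_eq_mul_inv, ← ENNReal.tsum_mul_right]
    refine tsum_congr fun w => ?_
    rw [ENNReal.inv_pow, ENNReal.inv_pow, pow_succ]
    ring
  rw [h1]
  simp_rw [h2]
  rw [ENNReal.tsum_comm]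
  simp [div_eq_mul_inv, ENNReal.tsum_mul_left, ENNReal.tsum_mul_right]

/-- A positive superharmonic vector that is strictly superharmonic on `T`. -/
theorem IsTransient.exists_superharmonic {M : Matrix V V ℝ≥0} (hM : IsTransient M)
    (hs : (digraph M).IsStrong) {L : ℝ≥0} (hL : lambda M = L) (hL0 : L ≠ 0)
    {T : Finset V} (hT : T.Nonempty) :
    ∃ u : V → ℝ≥0, (∀ v, 0 < u v) ∧ (∀ v, ∀ F : Finset V, ∑ w ∈ F, M v w * u w ≤ L * u v) ∧
      ∀ v ∈ T, ∀ F : Finset V, ∑ w ∈ F, M v w * u w + L ≤ L * u v := by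
  classical
  have hL' : (L : ℝ≥0∞) ≠ 0 := by exact_mod_cast hL0
  set G : V → V → ℝ≥0∞ := fun v t => ∑' p, powEntry M p v t / (L : ℝ≥0∞) ^ p with hG
  have hGfin : ∀ v t, G v t ≠ ∞ := fun v t => by simpa only [hG, ← hL] using hM.2 v t
  set u : V → ℝ≥0∞ := fun v => ∑ t ∈ T, G v t with hu
  have hufin : ∀ v, u v ≠ ∞ := fun v => ENNReal.sum_ne_top.2 fun t _ => hGfin v t
  have hupos : ∀ v, u v ≠ 0 := by
    intro v h0
    obtain ⟨t, ht⟩ := hT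
    have h1 : G v t = 0 := (Finset.sum_eq_zero_iff.1 h0) t ht
    have hr : Relation.ReflTransGen (digraph M).Adj v t := by
      by_cases hvt : v = t
      · exact hvt ▸ Relation.ReflTransGen.refl
      · exact (hs v t hvt).to_reflTransGen
    obtain ⟨p, hp⟩ := exists_powEntry_ne_zero hr
    have h2 := ENNReal.tsum_eq_zero.1 h1 p
    rw [ENNReal.div_eq_zero_iff] at h2
    exact h2.elim hp (ENNReal.pow_ne_top ENNReal.coe_ne_top)
  -- The resolvent identity LG = L·1 + MG, summed over T: the first term is L on T and 0 elsewhere.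
  have heq : ∀ v, L * u v = L * (∑ t ∈ T, powEntry M 0 v t) + ∑' w, (M v w : ℝ≥0∞) * u w := by
    intro v
    have h1 : ∀ t, L * G v t = L * powEntry M 0 v t + ∑' w, (M v w : ℝ≥0∞) * G w t := by
      intro t
      rw [hG]
      simp only
      rw [tsum_powEntry_div_eq, mul_add, ENNReal.mul_div_cancel hL' ENNReal.coe_ne_top]
    simp only [hu, Finset.mul_sum, h1]
    rw [Finset.sum_add_distrib, Summable.tsum_finsetSum (fun _ _ => ENNReal.summable)]
  have hsum : ∀ v, ∀ F : Finset V, ((∑ w ∈ F, M v w * (u w).toNNReal : ℝ≥0) : ℝ≥0∞) ≤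
      ∑' w, (M v w : ℝ≥0∞) * u w := by
    intro v F
    push_cast
    simp_rw [ENNReal.coe_toNNReal (hufin _)]
    exact ENNReal.sum_le_tsum F
  refine ⟨fun v => (u v).toNNReal, fun v => ENNReal.toNNReal_pos (hupos v) (hufin v),
    fun v F => ?_, fun v hv F => ?_⟩
  · rw [← ENNReal.coe_le_coe, ENNReal.coe_mul L, ENNReal.coe_toNNReal (hufin _), heq]
    exact (hsum v F).trans le_add_self
  · rw [← ENNReal.coe_le_coe, ENNReal.coe_mul L, ENNReal.coe_toNNReal (hufin _), heq,
      ENNReal.coe_add, add_comm]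
    have : ∑ t ∈ T, powEntry M 0 v t = 1 := by simp [powEntry, hv]
    rw [this, mul_one]
    gcongr
    exact hsum v F

/-- Off T, the height of v counts the vertices of F that reach v by a nonempty walk avoiding T.
Acyclicity keeps v out of its own count, so an arc leaving v adds at least v itself. -/
theorem exists_height {D : Digraph V} {T : Set V} (hT : D.IsCycleTransversal T) (F : Finset V) :
    ∃ h : V → ℕ, (∀ v ∈ T, h v = F.card) ∧
      ∀ v ∈ F, v ∉ T → ∀ w, D.Adj v w → h v + 1 ≤ h w := by
  classical
  have hac : ∀ v, ¬ Relation.TransGen (D.deleteVertices T).Adj v v := fun v hv =>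
    (Digraph.exists_isDirectedCycle_of_transGen _ hv).elim hT
  let A : V → Finset V := fun v => F.filter fun z => ∃ hz : z ∉ T, ∃ hv : v ∉ T,
    Relation.TransGen (D.deleteVertices T).Adj ⟨z, hz⟩ ⟨v, hv⟩
  have hnot : ∀ v, v ∉ A v := fun v hv => by
    obtain ⟨-, _, _, h⟩ := Finset.mem_filter.1 hv
    exact hac _ h
  refine ⟨fun v => if v ∈ T then F.card else (A v).card, fun v hv => by simp [hv],
    fun v hvF hvT w hvw => ?_⟩
  simp only [hvT, if_false]
  rw [← Finset.card_insert_of_notMem (hnot v)]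
  have hsub : insert v (A v) ⊆ F :=
    Finset.insert_subset hvF (Finset.filter_subset _ _)
  split_ifs with hwT
  · exact Finset.card_le_card hsub
  · refine Finset.card_le_card fun z hz => ?_
    refine Finset.mem_filter.2 ⟨hsub hz, ?_⟩
    have hadj : (D.deleteVertices T).Adj ⟨v, hvT⟩ ⟨w, hwT⟩ := hvw
    rcases Finset.mem_insert.1 hz with rfl | hz
    · exact ⟨hvT, hwT, .single hadj⟩
    · obtain ⟨-, hzT, _, h⟩ := Finset.mem_filter.1 hz
      exact ⟨hzT, hwT, h.tail hadj⟩

/-- Test vector u · s ^ h with h the height: off T every arc gains a factor s, while on T, where h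
is the order of F, the assumed deficit pays for all powers of s at once. -/
theorem perronRoot_le_of_superharmonic {M : Matrix V V ℝ≥0} {T : Set V}
    (hT : (digraph M).IsCycleTransversal T) {u : V → ℝ≥0} {L s : ℝ≥0} {F : Finset V}
    (hu : ∀ v, 0 < u v) (hM : ∀ v, ∑ w ∈ F, M v w * u w ≤ L * u v) (hs0 : 0 < s) (hs1 : s ≤ 1)
    (hMT : ∀ v ∈ T, ∑ w ∈ F, M v w * u w ≤ s ^ (F.card + 1) * (L * u v)) :
    perronRoot M F ≤ (s * L : ℝ≥0) := by
  obtain ⟨h, heq, hlt⟩ := exists_height hT F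
  refine perronRoot_le (x := fun v => u v * s ^ h v)
    (fun v _ => mul_pos (hu v) (pow_pos hs0 _)) fun v hv => ?_
  by_cases hvT : v ∈ T
  · calc ∑ w ∈ F, M v w * (u w * s ^ h w) ≤ ∑ w ∈ F, M v w * u w := by
          refine Finset.sum_le_sum fun w _ => ?_
          rw [← mul_assoc]
          exact mul_le_of_le_one_right' (pow_le_one' hs1 _)
      _ ≤ s ^ (F.card + 1) * (L * u v) := hMT v hvT
      _ = s * L * (u v * s ^ h v) := by rw [heq v hvT]; ring
  · calc ∑ w ∈ F, M v w * (u w * s ^ h w) ≤ ∑ w ∈ F, M v w * u w * s ^ (h v + 1) := by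
          refine Finset.sum_le_sum fun w _ => ?_
          by_cases h0 : M v w = 0
          · simp [h0]
          · rw [mul_assoc]
            exact mul_le_mul' le_rfl
              (mul_le_mul' le_rfl (pow_le_pow_of_le_one zero_le hs1 (hlt v hv hvT w h0)))
      _ = (∑ w ∈ F, M v w * u w) * s ^ (h v + 1) := (Finset.sum_mul _ _ _).symm
      _ ≤ L * u v * s ^ (h v + 1) := by gcongr; exact hM v
      _ = s * L * (u v * s ^ h v) := by ring

theorem slowApproximation_of_isCycleTransversal {D : Digraph V} (hD : D.IsStrong)
    (harc : ∃ v w : V, D.Adj v w) {T : Set V} (hfin : T.Finite) (hT : D.IsCycleTransversal T) :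
    SlowApproximation D := by
  rintro M ⟨rfl, hM⟩
  obtain ⟨a, b, hab⟩ := harc
  obtain ⟨L, hL⟩ : ∃ L : ℝ≥0, lambda M = L := ⟨_, (ENNReal.coe_toNNReal hM.1).symm⟩
  have hL0 : L ≠ 0 := by
    have := hM.lambda_ne_zero hab
    rw [hL] at this
    exact_mod_cast this
  lift T to Finset V using hfin
  -- A strong digraph with an arc has a cycle, so the empty set is no transversal.
  have hTne : T.Nonempty := by
    by_contra hne
    rw [Finset.not_nonempty_iff_eq_empty] at hne
    subst hne
    have hcyc : Relation.TransGen (digraph M).Adj a a := by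
      by_cases hba : b = a
      · exact .single (hba ▸ hab)
      · exact (Relation.TransGen.single hab).trans (hD b a hba)
    have hcyc' : Relation.TransGen ((digraph M).deleteVertices (∅ : Finset V)).Adj
        ⟨a, by simp⟩ ⟨a, by simp⟩ :=
      hcyc.lift (fun v : V => (⟨v, by simp⟩ : {v : V // v ∉ ((∅ : Finset V) : Set V)}))
        (fun _ _ h => h)
    exact (Digraph.exists_isDirectedCycle_of_transGen _ hcyc').elim hT
  obtain ⟨u, hu, huM, huT⟩ := hM.exists_superharmonic hD hL hL0 hTne
  obtain ⟨U, hU1, hU⟩ : ∃ U : ℝ≥0, 0 < U ∧ ∀ t ∈ T, u t ≤ U + 1 :=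
    ⟨∑ t ∈ T, u t, Finset.sum_pos (fun t _ => hu t) hTne, fun t ht =>
      (Finset.single_le_sum (f := u) (fun _ _ => zero_le) ht).trans le_self_add⟩
  -- For x ≤ U + 1 one has x - 1 ≤ r x, which turns the additive deficit L on T into a factor r.
  set r : ℝ≥0 := U / (U + 1) with hr
  have hr0 : 0 < r := by positivity
  have hr1 : r < 1 := (div_lt_one (by positivity)).2 (lt_add_one U)
  have hrT : ∀ t ∈ T, ∀ F : Finset V, ∑ w ∈ F, M t w * u w ≤ r * (L * u t) := by
    intro t ht F
    have h1 := huT t ht F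
    have h2 := hU t ht
    rw [← NNReal.coe_le_coe] at h1 h2 ⊢
    push_cast [hr] at h1 h2 ⊢
    have h3 : (u t : ℝ) - 1 ≤ U / (U + 1) * u t := by
      rw [div_mul_eq_mul_div, le_div_iff₀ (by positivity)]
      nlinarith
    nlinarith [mul_le_mul_of_nonneg_left h3 L.coe_nonneg]
  have hLpos : (0 : ℝ) < L := by exact_mod_cast pos_iff_ne_zero.2 hL0
  have hr1' : (0 : ℝ) < 1 - r := by
    have : (r : ℝ) < 1 := by exact_mod_cast hr1
    linarith
  -- Since n + 1 ≤ 2n, Bernoulli yields L(1 - r)/2; the 3 makes the inequality strict.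
  refine ⟨L * (1 - r) / 3, by positivity, fun n hn => ?_⟩
  set s : ℝ≥0 := r ^ (((n + 1 : ℕ) : ℝ)⁻¹) with hs
  have hspow : s ^ (n + 1) = r := NNReal.rpow_inv_natCast_pow r (by omega)
  have hs0 : 0 < s := NNReal.rpow_pos hr0
  have hs1 : s ≤ 1 := NNReal.rpow_le_one hr1.le (by positivity)
  have hlam : lambdaN M n ≤ (s * L : ℝ≥0) := by
    refine iSup₂_le fun F hF => ?_
    refine perronRoot_le_of_superharmonic hT hu (fun v => huM v F) hs0 hs1 fun t ht => ?_
    rw [hF, hspow]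
    exact hrT t ht F
  have hlam' : (lambdaN M n).toReal ≤ s * L := by
    have := ENNReal.toReal_mono ENNReal.coe_ne_top hlam
    simpa using this
  have hbern : 1 + ((n + 1 : ℕ) : ℝ) * ((s : ℝ) - 1) ≤ r := by
    have h1 := one_add_mul_le_pow (a := (s : ℝ) - 1) (by linarith [s.coe_nonneg]) (n + 1)
    rw [add_sub_cancel] at h1
    refine h1.trans_eq ?_
    exact_mod_cast hspow
  have hn' : (1 : ℝ) ≤ n := by exact_mod_cast hn
  have hgap : L * (1 - s) ≤ gap M n := by
    rw [gap, hL, ENNReal.coe_toReal]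
    linarith
  have hs1' : (0 : ℝ) ≤ 1 - s := by
    have : (s : ℝ) ≤ 1 := by exact_mod_cast hs1
    linarith
  push_cast at hbern
  have h5 : (1 - r : ℝ) ≤ 2 * (n * (1 - s)) := by nlinarith
  have h6 : (n : ℝ) * (L * (1 - s)) ≤ n * gap M n := by gcongr
  nlinarith [mul_le_mul_of_nonneg_left h5 hLpos.le, mul_pos hLpos hr1']

/-- The choice g(n) = 1/n² is incompatible with a gap of order at least 1/n. -/
theorem not_fastApproximation_and_slowApproximation (D : Digraph V) :
    ¬ (FastApproximation D ∧ SlowApproximation D) := by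
  rintro ⟨hf, hs⟩
  obtain ⟨M, hM, hg⟩ := hf (fun n => 1 / (n : ℝ) ^ 2) fun n hn => by positivity
  obtain ⟨c, hc, hcM⟩ := hs M hM
  obtain ⟨n, hn⟩ := exists_nat_gt (1 / c)
  have hn0 : (0 : ℝ) < n := (one_div_pos.2 hc).trans hn
  have hn1 : 1 ≤ n := by exact_mod_cast hn0
  have h1 := hcM n hn1
  have h2 : (n : ℝ) * gap M n ≤ n * (1 / (n : ℝ) ^ 2) := by gcongr; exact (hg n hn1).le
  have h3 : (n : ℝ) * (1 / (n : ℝ) ^ 2) = 1 / n := by field_simp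
  rw [h3] at h2
  have h4 : 1 / (n : ℝ) < c := (one_div_lt hn0 hc).2 hn
  linarith

/-! ### Fast approximation without a finite transversal -/

/-- Greedy choice: the union of finitely many chosen sets is not a transversal, so some cycle avoids
it. -/
theorem exists_disjoint_closed_finsets {D : Digraph V}
    (h : ¬ ∃ T : Set V, T.Finite ∧ D.IsCycleTransversal T) :
    ∃ C : ℕ → Finset V, (∀ k, (C k).Nonempty) ∧ (∀ k, ∀ v ∈ C k, ∃ w ∈ C k, D.Adj v w) ∧
      ∀ i j, i ≠ j → Disjoint (C i) (C j) := by
  classical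
  have : Std.Symm (Disjoint : Finset V → Finset V → Prop) := ⟨fun _ _ h => h.symm⟩
  obtain ⟨C, h1, h2⟩ := exists_seq_of_forall_finset_exists'
    (fun C : Finset V => C.Nonempty ∧ ∀ v ∈ C, ∃ w ∈ C, D.Adj v w) Disjoint
    (fun S _ => by
      have hS : ¬ D.IsCycleTransversal ((S.biUnion id : Finset V) : Set V) := fun hS =>
        h ⟨_, Finset.finite_toSet _, hS⟩
      unfold Digraph.IsCycleTransversal at hS
      push Not at hS
      obtain ⟨c, hc⟩ := hS
      obtain ⟨C, hne, hC⟩ := hc.exists_finset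
      refine ⟨C.map (Function.Embedding.subtype _), ⟨hne.map, ?_⟩, ?_⟩
      · intro v hv
        obtain ⟨v', hv', rfl⟩ := Finset.mem_map.1 hv
        obtain ⟨w, hw, hvw⟩ := hC v' hv'
        exact ⟨w, Finset.mem_map_of_mem _ hw, hvw⟩
      · intro B hB
        rw [Finset.disjoint_right]
        intro v hv hvB
        obtain ⟨v, -, rfl⟩ := Finset.mem_map.1 hv
        exact v.2 (by simpa using ⟨B, hB, hvB⟩))
  exact ⟨C, fun k => (h1 k).1, fun k => (h1 k).2, fun i j hij => h2 hij⟩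

theorem exists_pos_lt_of_lt {g : ℕ → ℝ} (hg : ∀ n, 1 ≤ n → 0 < g n) (N : ℕ) :
    ∃ e : ℝ≥0, 0 < e ∧ ∀ n, 1 ≤ n → n < N → (e : ℝ) < g n := by
  induction N with
  | zero => exact ⟨1, one_pos, fun n _ h => absurd h (by omega)⟩
  | succ N ih =>
    obtain ⟨e, he, h⟩ := ih
    by_cases hN : 1 ≤ N
    · refine ⟨min e ((g N).toNNReal / 2), lt_min he (half_pos (by simpa using hg N hN)),
        fun n h1 h2 => ?_⟩
      rcases Nat.lt_succ_iff_lt_or_eq.1 h2 with h3 | rfl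
      · exact lt_of_le_of_lt (by exact_mod_cast min_le_left _ _) (h n h1 h3)
      · refine lt_of_le_of_lt (NNReal.coe_le_coe.2 (min_le_right _ _)) ?_
        have := hg n hN
        push_cast
        rw [Real.coe_toNNReal _ this.le]
        linarith
    · exact ⟨e, he, fun n h1 h2 => absurd h1 (by omega)⟩

open Classical in
/-- The matrix with digraph `D` that puts weight `L - e v` on the arc from `v` to `s v` and divides
half of the remaining weight `e v` among all arcs out of `v`. -/
noncomputable def concentrated (D : Digraph V) (enc : V → ℕ) (s : V → V) (L : ℝ≥0)
    (e : V → ℝ≥0) : Matrix V V ℝ≥0 :=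
  fun v w => if D.Adj v w then (if w = s v then L - e v else 0) + e v / 2 / 2 / 2 ^ enc w else 0

theorem digraph_concentrated {D : Digraph V} {enc : V → ℕ} {s : V → V} {L : ℝ≥0} {e : V → ℝ≥0}
    (he : ∀ v, 0 < e v) : digraph (concentrated D enc s L e) = D := by
  ext v w
  have := he v
  by_cases h : D.Adj v w
  · simp [digraph, concentrated, h, this.ne']
  · simp [digraph, concentrated, h]

/-- The geometric weights use at most e v / 2; the other half is the row defect needed for
transience. -/
theorem tsum_concentrated_le {D : Digraph V} {enc : V → ℕ} (henc : Function.Injective enc)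
    {s : V → V} {L : ℝ≥0} {e : V → ℝ≥0} (he : ∀ v, e v ≤ L) (v : V) :
    ∑' w, (concentrated D enc s L e v w : ℝ≥0∞) + (e v / 2 : ℝ≥0) ≤ L := by
  classical
  have hgeo : ∑' n : ℕ, ((e v / 2 / 2 / 2 ^ n : ℝ≥0) : ℝ≥0∞) = (e v / 2 : ℝ≥0) := by
    rw [← ENNReal.coe_tsum (NNReal.summable_coe.1 (by
      push_cast; exact summable_geometric_two' _))]
    congr 1
    rw [← NNReal.coe_inj, NNReal.coe_tsum]
    push_cast
    exact tsum_geometric_two' _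
  calc ∑' w, (concentrated D enc s L e v w : ℝ≥0∞) + (e v / 2 : ℝ≥0)
      ≤ ∑' w, ((if w = s v then ((L - e v : ℝ≥0) : ℝ≥0∞) else 0) +
          ((e v / 2 / 2 / 2 ^ enc w : ℝ≥0) : ℝ≥0∞)) + (e v / 2 : ℝ≥0) := by
        gcongr with w
        unfold concentrated
        split_ifs <;> simp
    _ ≤ (L - e v : ℝ≥0) + (e v / 2 : ℝ≥0) + (e v / 2 : ℝ≥0) := by
        rw [ENNReal.tsum_add, tsum_ite_eq, ← hgeo]
        gcongr
        exact ENNReal.tsum_comp_le_tsum_of_injective henc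
          (fun n => ((e v / 2 / 2 / 2 ^ n : ℝ≥0) : ℝ≥0∞))
    _ = L := by
        norm_cast
        rw [add_assoc, add_halves, tsub_add_cancel_of_le (he v)]

theorem le_concentrated {D : Digraph V} {enc : V → ℕ} {s : V → V} {L : ℝ≥0} {e : V → ℝ≥0} {v : V}
    (h : D.Adj v (s v)) : L - e v ≤ concentrated D enc s L e v (s v) := by
  simp [concentrated, h]

theorem fastApproximation_of_forall_not_isCycleTransversal [Countable V] {D : Digraph V}
    (h : ¬ ∃ T : Set V, T.Finite ∧ D.IsCycleTransversal T) : FastApproximation D := by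
  classical
  have : Infinite V := by
    by_contra hfin
    rw [not_infinite_iff_finite] at hfin
    exact h ⟨Set.univ, Set.finite_univ, fun c hc => hc.1 (by
      induction c using Cycle.induction_on with
      | nil => rfl
      | cons a _ _ => exact absurd trivial a.2)⟩
  obtain ⟨enc, henc⟩ := exists_injective_nat V
  obtain ⟨C, hne, hC, hdisj⟩ := exists_disjoint_closed_finsets h
  intro g hg
  choose ε hε0 hε using exists_pos_lt_of_lt hg
  set m : ℕ → ℕ := fun k => ∑ j ∈ Finset.range (k + 1), (C j).card with hm
  have hmono : StrictMono m := strictMono_nat_of_lt_succ fun k => by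
    have := (hne (k + 1)).card_pos
    simp only [hm]
    rw [Finset.sum_range_succ _ (k + 1)]
    omega
  have hcard : ∀ k, (C k).card ≤ m k := fun k =>
    Finset.single_le_sum (f := fun j => (C j).card) (fun _ _ => Nat.zero_le _) (by simp)
  -- For n < m 0 the bounds from the cycles are not available; there the gap is at most L, which is
  -- already below g n.
  set L : ℝ≥0 := ε (m 0) with hL
  have hL0 : 0 < L := hε0 _
  -- The first term beats g n for all n < m (k + 1); the second makes d tend to 0, so that λ(M) = L.
  set d : ℕ → ℝ≥0 := fun k => min (ε (m (k + 1))) (L / (k + 1)) with hd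
  have hd0 : ∀ k, 0 < d k := fun k => lt_min (hε0 _) (by positivity)
  have hdL : ∀ k, d k ≤ L := fun k => (min_le_right _ _).trans (div_le_self zero_le (by simp))
  let e : V → ℝ≥0 := fun v => if hv : ∃ k, v ∈ C k then d hv.choose else L
  have he : ∀ k, ∀ v ∈ C k, e v = d k := by
    intro k v hv
    have hex : ∃ k, v ∈ C k := ⟨k, hv⟩
    have : hex.choose = k := by
      by_contra hcon
      exact Finset.disjoint_left.1 (hdisj _ _ hcon) hex.choose_spec hv
    simp [e, hex, this]
  have he0 : ∀ v, 0 < e v := fun v => by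
    simp only [e]; split_ifs
    exacts [hd0 _, hL0]
  have heL : ∀ v, e v ≤ L := fun v => by
    simp only [e]; split_ifs
    exacts [hdL _, le_rfl]
  have hs : ∀ v, ∃ w, ∀ k, v ∈ C k → w ∈ C k ∧ D.Adj v w := by
    intro v
    by_cases hv : ∃ k, v ∈ C k
    · obtain ⟨k, hk⟩ := hv
      obtain ⟨w, hw, hvw⟩ := hC k v hk
      refine ⟨w, fun j hj => ?_⟩
      have : j = k := by
        by_contra hcon
        exact Finset.disjoint_left.1 (hdisj _ _ hcon) hj hk
      exact this ▸ ⟨hw, hvw⟩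
    · exact ⟨v, fun k hk => absurd ⟨k, hk⟩ hv⟩
  choose s hs using hs
  set M := concentrated D enc s L e with hM
  have hrow : ∀ v, ∑' w, (M v w : ℝ≥0∞) + (e v / 2 : ℝ≥0) ≤ L := tsum_concentrated_le henc heL
  have hperron : ∀ k, ∀ F : Finset V, C k ⊆ F → ((L - d k : ℝ≥0) : ℝ≥0∞) ≤ perronRoot M F := by
    intro k F hF
    refine le_perronRoot hF (hne k) fun v hv => ⟨s v, (hs v k hv).1, ?_⟩
    rw [← he k v hv]
    exact le_concentrated (hs v k hv).2
  have hlamN : ∀ k n, m k ≤ n → ((L - d k : ℝ≥0) : ℝ≥0∞) ≤ lambdaN M n := by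
    intro k n hn
    obtain ⟨F, hF, hFn⟩ := Infinite.exists_superset_card_eq (C k) n ((hcard k).trans hn)
    exact (hperron k F hF).trans (le_iSup₂ (f := fun F (_ : F.card = n) => perronRoot M F) F hFn)
  have hlam : lambda M = L := by
    refine le_antisymm (lambda_le_of_rowSum_le fun v => le_self_add.trans (hrow v)) ?_
    refine ENNReal.le_of_forall_pos_le_add fun η hη _ => ?_
    obtain ⟨k, hk⟩ := exists_nat_gt (L / η)
    have hdk : d k ≤ η := by
      refine (min_le_right _ _).trans ?_
      rw [div_le_iff₀ (by positivity)]
      rw [div_lt_iff₀ hη] at hk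
      calc L ≤ k * η := hk.le
        _ ≤ η * (k + 1) := by rw [mul_comm]; gcongr; exact le_self_add
    calc (L : ℝ≥0∞) ≤ ((L - d k : ℝ≥0) : ℝ≥0∞) + η := by
          norm_cast
          exact tsub_le_iff_right.1 (tsub_le_tsub_left hdk L)
      _ ≤ lambda M + η := by
          gcongr
          exact (hperron k (C k) subset_rfl).trans (le_iSup (perronRoot M) _)
  refine ⟨M, ⟨digraph_concentrated he0, isTransient_of_rowSum_lt hL0.ne'
    (fun v => (half_pos (he0 v)).ne') hrow hlam⟩, fun n hn => ?_⟩
  rw [gap, hlam, ENNReal.coe_toReal]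
  by_cases hn0 : n < m 0
  · have := hε (m 0) n hn hn0
    have h0 : 0 ≤ (lambdaN M n).toReal := ENNReal.toReal_nonneg
    linarith
  · obtain ⟨k, hk1, hk2⟩ : ∃ k, m k ≤ n ∧ n < m (k + 1) := by
      have hex : ∃ k, n < m k := ⟨n + 1, hmono.le_apply⟩
      refine ⟨Nat.find hex - 1, ?_, ?_⟩
      · have := Nat.find_min hex (m := Nat.find hex - 1)
        have h1 : Nat.find hex ≠ 0 := fun h0 => hn0 (h0 ▸ Nat.find_spec hex)
        have := this (by omega)
        omega
      · have h1 : Nat.find hex ≠ 0 := fun h0 => hn0 (h0 ▸ Nat.find_spec hex)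
        rw [Nat.sub_add_cancel (by omega)]
        exact Nat.find_spec hex
    have h1 : ((L - d k : ℝ≥0) : ℝ) ≤ (lambdaN M n).toReal := by
      have := ENNReal.toReal_mono (ne_top_of_le_ne_top (hlam ▸ ENNReal.coe_ne_top)
        (lambdaN_le_lambda M n)) (hlamN k n hk1)
      rwa [ENNReal.coe_toReal] at this
    rw [NNReal.coe_sub (hdL k)] at h1
    have h2 : (d k : ℝ) ≤ ε (m (k + 1)) := by exact_mod_cast min_le_left _ _
    have h3 := hε (m (k + 1)) n hn hk2
    linarith

end NonnegMatrix

theorem theorem2 {V : Type*} [Countable V] (D : Digraph V) (hD : D.IsStrong)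
    (harc : ∃ v w : V, D.Adj v w) :
    Xor (NonnegMatrix.FastApproximation D) (NonnegMatrix.SlowApproximation D) ∧
      (NonnegMatrix.SlowApproximation D ↔ ∃ T : Set V, T.Finite ∧ D.IsCycleTransversal T) := by
  have hns := NonnegMatrix.not_fastApproximation_and_slowApproximation D
  by_cases h : ∃ T : Set V, T.Finite ∧ D.IsCycleTransversal T
  · obtain ⟨T, hfin, hT⟩ := h
    have hs := NonnegMatrix.slowApproximation_of_isCycleTransversal hD harc hfin hT
    exact ⟨.inr ⟨hs, fun hf => hns ⟨hf, hs⟩⟩, fun _ => ⟨T, hfin, hT⟩, fun _ => hs⟩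
  · have hf := NonnegMatrix.fastApproximation_of_forall_not_isCycleTransversal h
    exact ⟨.inl ⟨hf, fun hs => hns ⟨hf, hs⟩⟩, fun hs => absurd ⟨hf, hs⟩ hns, fun hT => absurd hT h⟩
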